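/- Let $k$ be an algebraically closed field of characteristic $p>0$, let $S=k[[x_1,x_2]]$, and let $G$ be a finite group scheme over $k$ that is linearly reductive, i.e. every finite-dimensional $k$-linear representation of $G$ is semisimple. Let $G$ act on the $k$-scheme $\operatorname{Spec} S$, and put $R:=S^G\subseteq S$, with quotient morphism $\pi:\operatorname{Spec} S\to\operatorname{Spec} R$. Assume that the action is free in codimension one: there is a closed subset $Z\subset\operatorname{Spec} S$ of codimension at least two whose complement $V$ is $G$-stable and such that, with $U:=\operatorname{Spec} R\setminus\pi(Z)$, the morphism $V\times_{\operatorname{Spec} k}G\to V\times_U V$, $(v,g)\mapsto(v,gv)$, is an isomorphism. Let $\mathrm{add}_R(S)$ be the full subcategory of $R$-modules that are isomorphic to direct summands of finite direct sums of copies of $S$, and let $\mathcal L$ be the full subcategory of finite (i.e. finitely generated) reflexive $R$-modules. Then: 1. Up to isomorphism, the indecomposable finite reflexive $R$-modules are precisely the indecomposable $R$-module direct summands of $S$. 2. $\mathrm{add}_R(S)$ is contained in $\mathcal L$, and the inclusion $\mathrm{add}_R(S)\subseteq\mathcal L$ is an equivalence of categories; in fact $\mathrm{add}_R(S)=\mathcal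 L$. In particular, there are only finitely many isomorphism classes of indecomposable finite reflexive $R$-modules. -/

import Mathlib

open scoped TensorProduct
open CategoryTheory

universe u v w

namespace LRQ

section Coactions

variable {k : Type u} [Field k] {A : Type v} [CommRing A] [HopfAlgebra k A]

/-- A finite group scheme `G` over `k` is given by its coordinate ring `A = H⁰(G, 𝒪_G)`, a commutative
Hopf algebra that is finite-dimensional over `k`. A `k`-linear representation of `G` on `V` is a
right `A`-comodule structure `δ` on `V`: this is the coassociativity and the counit axiom. -/
structure IsCoaction {V : Type w} [AddCommGroup V] [Module k V] (δ : V →ₗ[k] V ⊗[k] A) : Prop where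
  coassoc : (TensorProduct.assoc k V A A).toLinearMap ∘ₗ δ.rTensor A ∘ₗ δ =
    (Coalgebra.comul (R := k) (A := A)).lTensor V ∘ₗ δ
  counit : (TensorProduct.rid k V).toLinearMap ∘ₗ
    (Coalgebra.counit (R := k) (A := A)).lTensor V ∘ₗ δ = LinearMap.id

/-- `W` is a subrepresentation: `δ` maps `W` into `W ⊗ A`, seen inside `V ⊗ A`. -/
def IsSubrep {V : Type w} [AddCommGroup V] [Module k V] (δ : V →ₗ[k] V ⊗[k] A)
    (W : Submodule k V) : Prop :=
  ∀ x ∈ W, δ x ∈ LinearMap.range (W.subtype.rTensor A)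

/-- A representation is semisimple if every subrepresentation has a complementary
subrepresentation. -/
def IsSemisimpleRep {V : Type w} [AddCommGroup V] [Module k V] (δ : V →ₗ[k] V ⊗[k] A) : Prop :=
  ∀ W : Submodule k V, IsSubrep δ W → ∃ W' : Submodule k V, IsSubrep δ W' ∧ IsCompl W W'

variable (k A) in
/-- `G = Spec A` is linearly reductive: every finite-dimensional `k`-linear representation of `G` is
semisimple. (A finite-dimensional `V` has copies in the universe of `k`.) -/
def IsLinearlyReductive : Prop :=
  ∀ (V : Type u) [AddCommGroup V] [Module k V] [Module.Finite k V] (δ : V →ₗ[k] V ⊗[k] A),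
    IsCoaction δ → IsSemisimpleRep δ

variable {S : Type w} [CommRing S] [Algebra k S]

/-- An action of `G = Spec A` on the `k`-scheme `Spec S`: a homomorphism of `k`-algebras
`ρ : S → S ⊗ A` that makes `S` a right `A`-comodule algebra. -/
def IsAction (ρ : S →ₐ[k] S ⊗[k] A) : Prop :=
  IsCoaction ρ.toLinearMap

/-- The ring of invariants `S^G = {s | ρ s = s ⊗ 1}`. -/
def invariants (ρ : S →ₐ[k] S ⊗[k] A) : Subalgebra k S :=
  AlgHom.equalizer ρ Algebra.TensorProduct.includeLeft

/-- The coaction is linear over the invariants. -/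
def coactionOverInvariants (ρ : S →ₐ[k] S ⊗[k] A) : S →ₐ[invariants ρ] S ⊗[k] A :=
  { ρ.toRingHom with commutes' := fun r => r.2 }

/-- The Galois map `S ⊗_{S^G} S → S ⊗_k A`, `a ⊗ b ↦ (a ⊗ 1) * ρ b`, which on spectra is
`Spec S × G → Spec S ×_{Spec S^G} Spec S`, `(x, g) ↦ (x, g x)`. -/
noncomputable def galoisMap (ρ : S →ₐ[k] S ⊗[k] A) :
    S ⊗[invariants ρ] S →ₐ[invariants ρ] S ⊗[k] A :=
  Algebra.TensorProduct.productMap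
    (IsScalarTower.toAlgHom (invariants ρ) S (S ⊗[k] A)) (coactionOverInvariants ρ)

/-- The open complement `V` of `Z ⊆ Spec S` is `G`-stable: every point of `V × G = V × Spec A` is
mapped into `V` by the action morphism. -/
def ComplIsStable (ρ : S →ₐ[k] S ⊗[k] A) (Z : Set (PrimeSpectrum S)) : Prop :=
  ∀ P : PrimeSpectrum (S ⊗[k] A),
    PrimeSpectrum.comap (algebraMap S (S ⊗[k] A)) P ∉ Z → PrimeSpectrum.comap ρ.toRingHom P ∉ Z

/-- The action is free in codimension one: there is a closed `Z ⊆ Spec S` of codimension at least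
two, with `G`-stable complement `V`, such that over `U = Spec S^G \ π(Z)`, where `π` is the quotient
morphism, the morphism `V × G → V ×_U V`, `(x, g) ↦ (x, g x)`, is an isomorphism. Both sides being
affine over `U`, the last condition is checked at each point `𝔭` of `U`, that is, after localizing
the Galois map at `𝔭`. -/
def IsFreeInCodimOne (ρ : S →ₐ[k] S ⊗[k] A) : Prop :=
  ∃ Z : Set (PrimeSpectrum S), IsClosed Z ∧ (∀ q ∈ Z, 2 ≤ q.asIdeal.height) ∧
    ComplIsStable ρ Z ∧
    ∀ p : PrimeSpectrum (invariants ρ),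
      p ∉ PrimeSpectrum.comap (algebraMap (invariants ρ) S) '' Z →
        Function.Bijective
          (LocalizedModule.map p.asIdeal.primeCompl (galoisMap ρ).toLinearMap)

end Coactions

section Modules

variable (R : Type u) [CommRing R]

/-- A module is indecomposable if it is nonzero and is not the direct sum of two nonzero
submodules. -/
def IsIndecomposable (M : Type v) [AddCommGroup M] [Module R M] : Prop :=
  Nontrivial M ∧ ∀ N N' : Submodule R M, IsCompl N N' → N = ⊥ ∨ N' = ⊥

/-- `M` is isomorphic to a direct summand of `T`. -/
def IsSummand (M : Type v) (T : Type w) [AddCommGroup M] [Module R M] [AddCommGroup T]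
    [Module R T] : Prop :=
  ∃ (i : M →ₗ[R] T) (r : T →ₗ[R] M), r ∘ₗ i = LinearMap.id

/-- The full subcategory `add_R(T)` of summands of finite sums of copies of `T`. -/
def addCat (T : Type u) [AddCommGroup T] [Module R T] : ObjectProperty (ModuleCat.{u} R) :=
  fun M => ∃ n : ℕ, IsSummand R M (Fin n → T)

/-- The full subcategory of finite and reflexive `R`-modules. -/
def reflexiveCat : ObjectProperty (ModuleCat.{u} R) :=
  fun M => Module.Finite R M ∧ Module.IsReflexive R M

end Modules

end LRQ

namespace LRQ

/-! Linear reductivity provides a normalized integral `l` on `A`, hence an `R`-linear retraction `E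
: S → R`, the Reynolds operator. It makes `S` finite over `R`, and `R` a complete noetherian local
ring.

Reflexive modules lie in `add_R(S)`: a reflexive `M` is `Hom_R(M*, R)`, which `E` makes a summand of
`Hom_R(M*, S) = Hom_S(S ⊗ M*, S)`. This is a dual over a two-dimensional regular local ring, hence
free (`free_dual`).

Conversely, `S` is reflexive because the form `(a, b) ↦ E (a * b)` is perfect. Where the action is
free, inverting the Galois map at `1 ⊗ c`, for an integral element `c` of `A`, writes every
functional as `E (a * ·)` up to a denominator (`exists_smul_eq_reynolds_mul`). In dimension two only
the closed point is left, and coprimality of the two variables extends the representation over it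
(`isReflexive_of_retraction`).

Since `R` is complete, finite indecomposable modules have local endomorphism rings
(`isLocalRing_end`). The Krull–Schmidt argument then turns summands of `S^n` into summands of `S`
and leaves finitely many of them. -/

theorem finite_linearMap {R M N : Type*} [CommRing R] [IsNoetherianRing R] [AddCommGroup M]
    [Module R M] [AddCommGroup N] [Module R N] [Module.Finite R M] [Module.Finite R N] :
    Module.Finite R (M →ₗ[R] N) := by
  obtain ⟨n, f, hf⟩ := Module.Finite.exists_fin' R M
  exact Module.Finite.of_injective (LinearMap.lcomp R N f) fun g h hgh =>
    LinearMap.cancel_right hf |>.1 hgh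

/-! ### Duals over a two-dimensional regular local ring. -/

section DualFree

variable {S : Type*} [CommRing S] [IsLocalRing S] [IsNoetherianRing S]

/-- The quotient is a noetherian local domain whose maximal ideal is generated by the image of `y`,
so it is a field or a discrete valuation ring. -/
theorem isPrincipalIdealRing_quotient_span {x y : S}
    (hm : IsLocalRing.maximalIdeal S = Ideal.span {x, y}) (hx : Prime x) :
    IsPrincipalIdealRing (S ⧸ Ideal.span {x}) := by
  have : (Ideal.span {x}).IsPrime := (Ideal.span_singleton_prime hx.ne_zero).2 hx
  have : IsLocalRing (S ⧸ Ideal.span {x}) :=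
    .of_surjective' (Ideal.Quotient.mk _) Ideal.Quotient.mk_surjective
  suffices hp : (IsLocalRing.maximalIdeal (S ⧸ Ideal.span {x})).IsPrincipal from
    ((tfae_of_isNoetherianRing_of_isLocalRing_of_isDomain (S ⧸ Ideal.span {x})).out 0 4).2 hp
  refine ⟨⟨Ideal.Quotient.mk _ y, ?_⟩⟩
  have h : IsLocalRing.maximalIdeal (S ⧸ Ideal.span {x}) =
      (IsLocalRing.maximalIdeal S).map (Ideal.Quotient.mk (Ideal.span {x})) :=
    (IsLocalRing.map_maximalIdeal_of_surjective _ Ideal.Quotient.mk_surjective).symm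
  have hx0 : Ideal.Quotient.mk (Ideal.span {x}) x = 0 :=
    Ideal.Quotient.eq_zero_iff_mem.2 (Ideal.mem_span_singleton_self x)
  rw [h, hm, Ideal.map_span, Set.image_pair, hx0, Ideal.span_insert_zero]

open Pointwise in
/-- Over a local domain whose maximal ideal is generated by `x` and `y` with `x` prime, the dual
of a finite module is free. -/
theorem free_dual [IsDomain S] {x y : S}
    (hm : IsLocalRing.maximalIdeal S = Ideal.span {x, y}) (hx : Prime x)
    (N : Type*) [AddCommGroup N] [Module S N] [Module.Finite S N] :
    Module.Free S (N →ₗ[S] S) := by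
  have := isPrincipalIdealRing_quotient_span hm hx
  have : (Ideal.span {x}).IsPrime := (Ideal.span_singleton_prime hx.ne_zero).2 hx
  have : Module.Finite S (N →ₗ[S] S) := finite_linearMap
  have : Module.FinitePresentation S (N →ₗ[S] S) :=
    Module.finitePresentation_of_finite S _
  have hreg : IsSMulRegular (N →ₗ[S] S) x := fun f g h => by
    ext n
    exact mul_left_cancel₀ hx.ne_zero (LinearMap.congr_fun h n)
  have hjac : x ∈ (⊥ : Ideal S).jacobson := by
    rw [IsLocalRing.jacobson_eq_maximalIdeal _ bot_ne_top, hm]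
    exact Ideal.subset_span (by simp)
  -- As `x` is regular on the dual and lies in the Jacobson radical, freeness may be tested modulo
  -- `x`, over a principal ideal domain, where torsion-freeness suffices.
  rw [← Module.free_quotSMulTop_iff_free S (N →ₗ[S] S) hjac hreg]
  have : Module.Finite (S ⧸ Ideal.span {x}) (QuotSMulTop x (N →ₗ[S] S)) :=
    Module.Finite.of_restrictScalars_finite S _ _
  have : Module.IsTorsionFree (S ⧸ Ideal.span {x}) (QuotSMulTop x (N →ₗ[S] S)) := by
    refine .of_smul_eq_zero fun r m hrm => ?_
    obtain ⟨r, rfl⟩ := Ideal.Quotient.mk_surjective r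
    obtain ⟨f, rfl⟩ := Submodule.mkQ_surjective _ m
    rw [or_iff_not_imp_left, Ideal.Quotient.eq_zero_iff_mem, Ideal.mem_span_singleton]
    intro hr
    have h1 : r • f ∈ x • (⊤ : Submodule S (N →ₗ[S] S)) := by
      rw [← Submodule.Quotient.mk_eq_zero]
      exact hrm
    obtain ⟨g, -, hg⟩ := (Submodule.mem_smul_pointwise_iff_exists _ _ _).1 h1
    -- From `r * f n = x * g n` and `x ∤ r`, all values of `f` are divisible by `x`; the quotient `f
    -- / x` is again a functional, so `f` vanishes modulo `x`.
    have h2 : ∀ n, x ∣ f n := fun n => by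
      have := LinearMap.congr_fun hg n
      exact (hx.dvd_or_dvd (⟨g n, this.symm⟩ : x ∣ r * f n)).resolve_left hr
    choose c hc using h2
    refine (Submodule.Quotient.mk_eq_zero _).2 ?_
    refine (Submodule.mem_smul_pointwise_iff_exists _ _ _).2
      ⟨{ toFun := c, map_add' := fun a b => ?_, map_smul' := fun s a => ?_ }, trivial, ?_⟩
    · apply mul_left_cancel₀ hx.ne_zero
      rw [mul_add, ← hc, ← hc, ← hc, map_add]
    · apply mul_left_cancel₀ hx.ne_zero
      rw [← hc, map_smul, hc a]
      simp only [smul_eq_mul, RingHom.id_apply]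
      ring
    · ext n
      exact (hc n).symm
  exact Module.free_of_finite_type_torsion_free'

end DualFree

/-! ### Reflexive modules as summands of free `S`-modules. -/

section Summands

variable {R : Type*} [CommRing R]

theorem IsSummand.trans {M T U : Type*} [AddCommGroup M] [Module R M] [AddCommGroup T]
    [Module R T] [AddCommGroup U] [Module R U] (h : IsSummand R M T) (h' : IsSummand R T U) :
    IsSummand R M U := by
  obtain ⟨i, r, hr⟩ := h
  obtain ⟨i', r', hr'⟩ := h'
  refine ⟨i' ∘ₗ i, r ∘ₗ r', ?_⟩
  rw [LinearMap.comp_assoc, ← LinearMap.comp_assoc i, hr', LinearMap.id_comp, hr]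

theorem isSummand_of_equiv {M T : Type*} [AddCommGroup M] [Module R M] [AddCommGroup T]
    [Module R T] (e : M ≃ₗ[R] T) : IsSummand R M T :=
  ⟨e.toLinearMap, e.symm.toLinearMap, by ext; simp⟩

theorem IsSummand.finite {M T : Type*} [AddCommGroup M] [Module R M] [AddCommGroup T]
    [Module R T] [Module.Finite R T] (h : IsSummand R M T) : Module.Finite R M := by
  obtain ⟨i, r, hr⟩ := h
  exact Module.Finite.of_surjective r fun m => ⟨i m, LinearMap.congr_fun hr m⟩

theorem IsSummand.isReflexive {M T : Type*} [AddCommGroup M] [Module R M] [AddCommGroup T]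
    [Module R T] [Module.IsReflexive R T] (h : IsSummand R M T) : Module.IsReflexive R M := by
  obtain ⟨i, r, hr⟩ := h
  exact Module.IsReflexive.of_split i r hr

/-- If the base ring is a summand of the algebra `S`, then a reflexive module `M` is a summand of
`Hom_R(M*, S)`. -/
theorem isSummand_dual_of_isReflexive {S : Type*} [CommRing S] [Algebra R S]
    (E : S →ₗ[R] R) (hE : E 1 = 1)
    (M : Type*) [AddCommGroup M] [Module R M] [Module.IsReflexive R M] :
    IsSummand R M (Module.Dual R M →ₗ[R] S) := by
  refine (isSummand_of_equiv (Module.evalEquiv R M)).trans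
    ⟨(Algebra.linearMap R S).compRight R, E.compRight R, ?_⟩
  ext f m
  have : E (algebraMap R S (f m)) = f m := by
    rw [Algebra.algebraMap_eq_smul_one, map_smul, hE, smul_eq_mul, mul_one]
  exact this

/-- Finite reflexive modules over a summand `R` of `S` are summands of finite free `S`-modules, if
`S` is a noetherian local domain whose maximal ideal is generated by `x` and `y` with `x` prime. -/
theorem isSummand_pi_of_isReflexive [IsNoetherianRing R] {S : Type*} [CommRing S] [Algebra R S]
    [IsDomain S] [IsLocalRing S] [IsNoetherianRing S] {x y : S}
    (hm : IsLocalRing.maximalIdeal S = Ideal.span {x, y}) (hx : Prime x)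
    (E : S →ₗ[R] R) (hE : E 1 = 1)
    (M : Type*) [AddCommGroup M] [Module R M] [Module.Finite R M] [Module.IsReflexive R M] :
    ∃ n : ℕ, IsSummand R M (Fin n → S) := by
  have : Module.Finite R (Module.Dual R M) := finite_linearMap
  have : Module.Free S (S ⊗[R] Module.Dual R M →ₗ[S] S) := free_dual hm hx _
  have : Module.Finite S (S ⊗[R] Module.Dual R M →ₗ[S] S) := finite_linearMap
  refine ⟨_, (isSummand_dual_of_isReflexive E hE M).trans ((isSummand_of_equiv
    ((LinearMap.liftBaseChangeEquiv S).restrictScalars R)).trans (isSummand_of_equiv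
    ((Module.finBasis S (S ⊗[R] Module.Dual R M →ₗ[S] S)).equivFun.restrictScalars R)))⟩

end Summands

/-! ### The power series ring in two variables. -/

section BivariatePowerSeries

open MvPowerSeries

variable {k : Type u} [Field k]

/-- Under the identification of the ring with one-variable power series over `k[[x₂]]`, the first
variable becomes the power series variable over a domain. -/
theorem prime_X_zero : Prime (X 0 : MvPowerSeries (Fin 2) k) := by
  have h : finSuccEquiv k 1 (X 0) = PowerSeries.X := by
    ext n d
    rw [coeff_coeff_finSuccEquiv]
    classical
    rw [PowerSeries.coeff_X, MvPowerSeries.coeff_X]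
    have hd : d.cons n = Finsupp.single 0 1 ↔ n = 1 ∧ d = 0 := by
      constructor
      · intro h
        refine ⟨by simpa using DFunLike.congr_fun h 0, ?_⟩
        refine Finsupp.ext fun i => ?_
        simpa using DFunLike.congr_fun h i.succ
      · rintro ⟨rfl, rfl⟩
        ext i
        refine Fin.cases ?_ (fun j => ?_) i <;> simp
    by_cases hn : n = 1
    · subst hn
      simp only [hd, true_and, if_true, MvPowerSeries.coeff_one]
    · simp [hd, hn]
  have : IsDomain (MvPowerSeries (Fin 1) k) := NoZeroDivisors.to_isDomain _
  rw [← MulEquiv.prime_iff (finSuccEquiv k 1)]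
  rw [h]
  exact PowerSeries.X_prime

theorem not_X_zero_dvd_X_one : ¬ (X 0 : MvPowerSeries (Fin 2) k) ∣ X 1 := by
  rw [X_dvd_iff]
  intro h
  have := h (Finsupp.single 1 1) (by simp)
  rw [coeff_index_single_self_X] at this
  exact one_ne_zero this

theorem mem_span_X_pow (n : ℕ) (f : MvPowerSeries (Fin 2) k)
    (hf : ∀ d : Fin 2 →₀ ℕ, d.degree < n → coeff d f = 0) :
    f ∈ (Ideal.span {X 0, X 1} : Ideal (MvPowerSeries (Fin 2) k)) ^ n := by
  classical
  induction n generalizing f with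
  | zero => simp
  | succ n ih =>
    -- Monomials divisible by `X 0` go into `g₀`, the remaining ones into `g₁`; both have their
    -- order lowered by at most one.
    let g₀ : MvPowerSeries (Fin 2) k := fun d => coeff (d + Finsupp.single 0 1) f
    let g₁ : MvPowerSeries (Fin 2) k :=
      fun d => if d 0 = 0 then coeff (d + Finsupp.single 1 1) f else 0
    have h₀ : ∀ d, coeff d g₀ = coeff (d + Finsupp.single 0 1) f := fun d => rfl
    have h₁ : ∀ d, coeff d g₁ = if d 0 = 0 then coeff (d + Finsupp.single 1 1) f else 0 :=
      fun d => rfl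
    have hfg : f = X 0 * g₀ + X 1 * g₁ := by
      ext d
      rw [map_add, X_def, X_def, coeff_monomial_mul, coeff_monomial_mul, one_mul, one_mul]
      by_cases hd0 : d 0 = 0
      · have : ¬ Finsupp.single 0 1 ≤ d := fun h => by
          have := h 0
          simp [hd0] at this
        rw [if_neg this, zero_add]
        by_cases hd1 : d 1 = 0
        · have : ¬ Finsupp.single 1 1 ≤ d := fun h => by
            have := h 1
            simp [hd1] at this
          rw [if_neg this]
          apply hf
          have : d = 0 := by
            ext i; fin_cases i <;> simp [hd0, hd1]
          simp [this]
        · have : Finsupp.single 1 1 ≤ d := by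
            rw [Finsupp.single_le_iff]; omega
          rw [if_pos this, h₁, if_pos (by simp [hd0]), tsub_add_cancel_of_le this]
      · have : Finsupp.single 0 1 ≤ d := by
          rw [Finsupp.single_le_iff]; omega
        rw [if_pos this, h₀, tsub_add_cancel_of_le this]
        split_ifs with h
        · rw [h₁, if_neg (by simpa using hd0), add_zero]
        · rw [add_zero]
    have k₀ := ih g₀ fun d hd => by
      rw [h₀]; apply hf; simpa using hd
    have k₁ := ih g₁ fun d hd => by
      rw [h₁]
      split_ifs
      · apply hf; simpa using hd
      · rfl
    rw [hfg, pow_succ']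
    exact add_mem (Ideal.mul_mem_mul (Ideal.subset_span (by simp)) k₀)
      (Ideal.mul_mem_mul (Ideal.subset_span (by simp)) k₁)

theorem coeff_eq_zero_of_mem_span_X_pow (n : ℕ) (f : MvPowerSeries (Fin 2) k)
    (hf : f ∈ (Ideal.span {X 0, X 1} : Ideal (MvPowerSeries (Fin 2) k)) ^ n)
    (d : Fin 2 →₀ ℕ) (hd : d.degree < n) : coeff d f = 0 := by
  suffices h : (n : ℕ∞) ≤ f.order from
    coeff_of_lt_order (lt_of_lt_of_le (by exact_mod_cast hd) h)
  clear d hd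
  induction n generalizing f with
  | zero => simp
  | succ n ih =>
    rw [pow_succ'] at hf
    induction hf using Submodule.mul_induction_on' with
    | mem_mul_mem a ha b hb =>
      refine le_trans ?_ le_order_mul
      have h1 : (1 : ℕ∞) ≤ a.order := by
        rw [one_le_order_iff_constCoeff_eq_zero]
        obtain ⟨c, d, rfl⟩ := Ideal.mem_span_pair.1 ha
        simp
      rw [add_comm]
      push_cast
      exact add_le_add h1 (ih b hb)
    | add a _ b _ h1 h2 => exact le_trans (le_min h1 h2) min_order_le_add

theorem maximalIdeal_eq_span_X :
    IsLocalRing.maximalIdeal (MvPowerSeries (Fin 2) k) = Ideal.span {X 0, X 1} := by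
  ext f
  rw [IsLocalRing.mem_maximalIdeal, mem_nonunits_iff, isUnit_iff_constantCoeff, isUnit_iff_ne_zero,
    not_not]
  constructor
  · intro h
    rw [← pow_one (Ideal.span _)]
    apply mem_span_X_pow
    intro d hd
    have : d = 0 := by
      rw [← Finsupp.degree_eq_zero_iff]
      omega
    simpa [this] using h
  · intro h
    obtain ⟨c, d, rfl⟩ := Ideal.mem_span_pair.1 h
    simp

theorem isPrecomplete_maximalIdeal_mvPowerSeries :
    IsPrecomplete (IsLocalRing.maximalIdeal (MvPowerSeries (Fin 2) k))
      (MvPowerSeries (Fin 2) k) where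
  prec' f hf := by
    rw [maximalIdeal_eq_span_X] at hf ⊢
    simp only [smul_eq_mul, Ideal.mul_top] at hf ⊢
    -- Congruence modulo the `j`-th power of the maximal ideal fixes the coefficients of degree
    -- below `j`, so degree `d` stabilizes from index `d + 1` on.
    let L : MvPowerSeries (Fin 2) k := fun d => coeff d (f (d.degree + 1))
    have hL : ∀ d, coeff d L = coeff d (f (d.degree + 1)) := fun d => rfl
    refine ⟨L, fun n => ?_⟩
    rw [SModEq.sub_mem]
    apply mem_span_X_pow
    intro d hd
    have := SModEq.sub_mem.1 (hf (show d.degree + 1 ≤ n from hd))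
    have := coeff_eq_zero_of_mem_span_X_pow _ _ this d (Nat.lt_succ_self _)
    rw [map_sub, hL]
    rw [map_sub] at this
    rw [← neg_sub, this, neg_zero]

end BivariatePowerSeries

/-! ### Local endomorphism rings and the exchange property. -/

section LocalEndomorphisms

/-- For finite `M`, the completion of `M` is a quotient of the completion of `R` tensored with `M`,
and `R` already surjects onto its completion. -/
theorem isPrecomplete_of_finite {R : Type*} [CommRing R] (I : Ideal R) [IsPrecomplete I R]
    (M : Type*) [AddCommGroup M] [Module R M] [Module.Finite R M] : IsPrecomplete I M := by
  rw [← AdicCompletion.of_surjective_iff]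
  intro x
  obtain ⟨t, rfl⟩ := AdicCompletion.ofTensorProduct_surjective_of_finite I M x
  induction t with
  | zero => exact ⟨0, by simp⟩
  | add a b ha hb =>
    obtain ⟨a', ha⟩ := ha
    obtain ⟨b', hb⟩ := hb
    exact ⟨a' + b', by rw [map_add, map_add, ha, hb]⟩
  | tmul r m =>
    obtain ⟨r, rfl⟩ := AdicCompletion.of_surjective I R r
    refine ⟨r • m, ?_⟩
    rw [AdicCompletion.ofTensorProduct_tmul, map_smul]
    ext n
    rfl

theorem isArtinianRing_quotient_map_of_isMaximal {R B : Type*} [CommRing R] [CommRing B]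
    [Algebra R B] [Module.Finite R B] (m : Ideal R) [m.IsMaximal] :
    IsArtinianRing (B ⧸ m.map (algebraMap R B)) := by
  have : IsArtinianRing (R ⧸ m) := by
    let _ := Ideal.Quotient.field m
    infer_instance
  have : Module.Finite (R ⧸ m) (B ⧸ m.map (algebraMap R B)) :=
    Module.Finite.of_restrictScalars_finite R _ _
  exact IsArtinianRing.of_finite (R ⧸ m) _

theorem exists_isIdempotentElem_sub_mem {B : Type*} [CommRing B] (I : Ideal B) [HenselianRing B I]
    (a : B) (ha : a ^ 2 - a ∈ I) : ∃ c : B, IsIdempotentElem c ∧ c - a ∈ I := by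
  have hmon : (Polynomial.X ^ 2 - Polynomial.X : Polynomial B).Monic :=
    Polynomial.monic_X_pow_sub (lt_of_le_of_lt Polynomial.degree_X_le (by norm_num))
  have hder : Polynomial.eval a (Polynomial.derivative (Polynomial.X ^ 2 - Polynomial.X)) =
      2 * a - 1 := by
    simp [one_add_one_eq_two]
  obtain ⟨c, hc, hca⟩ := HenselianRing.is_henselian (I := I)
    (Polynomial.X ^ 2 - Polynomial.X) hmon a (by simpa using ha) (by
    rw [hder]
    -- The derivative is its own inverse modulo `I`: `(2a - 1)² = 4(a² - a) + 1`.
    refine IsUnit.of_mul_eq_one (Ideal.Quotient.mk I (2 * a - 1)) ?_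
    rw [← map_mul, ← map_one (Ideal.Quotient.mk I), Ideal.Quotient.eq]
    convert I.mul_mem_left 4 ha using 1
    ring)
  refine ⟨c, ?_, hca⟩
  have : c ^ 2 - c = 0 := by simpa using hc
  rw [IsIdempotentElem]
  linear_combination this

/-- Fitting's argument: the powers of `b` stabilize, `bⁿ = bⁿ⁺¹ y`, so `bⁿ⁺¹ yⁿ⁺¹` is idempotent. If
it is `0`, then `b` is nilpotent; if it is `1`, then `b` is a unit. -/
theorem isUnit_or_isUnit_one_sub_of_isArtinianRing {A : Type*} [CommRing A] [IsArtinianRing A]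
    (hA : ∀ e : A, IsIdempotentElem e → e = 0 ∨ e = 1) (b : A) : IsUnit b ∨ IsUnit (1 - b) := by
  obtain ⟨n, y, hn⟩ := IsArtinian.exists_pow_succ_smul_dvd (M := A) b 1
  simp only [smul_eq_mul, mul_one] at hn
  have h : ∀ j, b ^ (n + j) * y ^ j = b ^ n := by
    intro j
    induction j with
    | zero => simp
    | succ j ih =>
      calc b ^ (n + (j + 1)) * y ^ (j + 1) = (b ^ n.succ * y) * (b ^ j * y ^ j) := by
            rw [Nat.succ_eq_add_one]; ring
        _ = b ^ (n + j) * y ^ j := by rw [hn]; ring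
        _ = b ^ n := ih
  have h2 := h (n + 1)
  rcases hA (b ^ (n + 1) * y ^ (n + 1)) (by
    rw [IsIdempotentElem]
    calc _ = (b ^ (n + (n + 1)) * y ^ (n + 1)) * b * y ^ (n + 1) := by ring
      _ = _ := by rw [h2]; ring) with h0 | h1
  · right
    have : IsNilpotent b := ⟨n, by
      rw [← h2, pow_add, mul_assoc, h0, mul_zero]⟩
    exact this.isUnit_one_sub
  · left
    exact IsUnit.of_mul_eq_one (b ^ n * y ^ (n + 1)) (by rw [← h1]; ring)

/-- A finite connected algebra over a complete noetherian local ring is local. -/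
theorem isUnit_or_isUnit_one_sub_of_finite {R B : Type*} [CommRing R] [IsLocalRing R]
    [IsNoetherianRing R] [IsPrecomplete (IsLocalRing.maximalIdeal R) R] [CommRing B] [Algebra R B]
    [Module.Finite R B] (hB : ∀ e : B, IsIdempotentElem e → e = 0 ∨ e = 1) (b : B) :
    IsUnit b ∨ IsUnit (1 - b) := by
  set I : Ideal B := (IsLocalRing.maximalIdeal R).map (algebraMap R B) with hI
  have : IsPrecomplete (IsLocalRing.maximalIdeal R) B := isPrecomplete_of_finite _ _
  have : IsAdicComplete (IsLocalRing.maximalIdeal R) B := {}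
  have : IsAdicComplete I B := (IsAdicComplete.map_algebraMap_iff _ _).2 this
  have hloc := isLocalHom_of_le_jacobson_bot I (IsAdicComplete.le_jacobson_bot I)
  have : IsArtinianRing (B ⧸ I) := isArtinianRing_quotient_map_of_isMaximal _
  have hid : ∀ e : B ⧸ I, IsIdempotentElem e → e = 0 ∨ e = 1 := by
    intro e he
    obtain ⟨a, rfl⟩ := Ideal.Quotient.mk_surjective e
    obtain ⟨c, hc, hca⟩ := exists_isIdempotentElem_sub_mem I a (by
      rw [← Ideal.Quotient.eq, map_pow, pow_two, he.eq])
    rw [← (Ideal.Quotient.eq).2 hca]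
    rcases hB c hc with rfl | rfl <;> simp
  rcases isUnit_or_isUnit_one_sub_of_isArtinianRing hid (Ideal.Quotient.mk I b) with h | h
  · exact .inl (h.of_map)
  · rw [← map_one (Ideal.Quotient.mk I), ← map_sub] at h
    exact .inr (h.of_map)

theorem isIdempotentElem_eq_zero_or_one {R M : Type*} [CommRing R] [AddCommGroup M] [Module R M]
    (hM : IsIndecomposable R M) (e : Module.End R M) (he : IsIdempotentElem e) : e = 0 ∨ e = 1 := by
  rcases hM.2 _ _ (LinearMap.IsIdempotentElem.isCompl he) with h | h
  · exact .inl (LinearMap.range_eq_bot.1 h)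
  · right
    ext m
    exact LinearMap.ker_eq_bot.1 h (LinearMap.congr_fun he.eq m)

/-- The endomorphism ring of a finite indecomposable module over a complete noetherian local ring
is local. -/
theorem isLocalRing_end {R M : Type*} [CommRing R] [IsLocalRing R]
    [IsNoetherianRing R] [IsPrecomplete (IsLocalRing.maximalIdeal R) R] [AddCommGroup M]
    [Module R M] [Module.Finite R M] (hM : IsIndecomposable R M) :
    IsLocalRing (Module.End R M) := by
  have := hM.1
  refine IsLocalRing.of_isUnit_or_isUnit_one_sub_self fun f => ?_
  -- The commutative subalgebra `R[f]` is finite over `R` and has no nontrivial idempotents, so the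
  -- commutative case applies to it.
  let φ := Polynomial.aeval (R := R) f
  let ψ := Ideal.kerLiftAlg φ
  have hψ : Function.Injective ψ := Ideal.kerLiftAlg_injective φ
  have : Module.Finite R (Module.End R M) := finite_linearMap
  have : Module.Finite R (Polynomial R ⧸ RingHom.ker φ) :=
    Module.Finite.of_injective ψ.toLinearMap hψ
  have hb : ψ (Ideal.Quotient.mk _ Polynomial.X) = f := by
    simp [ψ, φ, Ideal.kerLiftAlg_mk]
  have hid : ∀ e : Polynomial R ⧸ RingHom.ker φ, IsIdempotentElem e → e = 0 ∨ e = 1 :=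
    fun e he => (isIdempotentElem_eq_zero_or_one hM (ψ e) (he.map ψ)).imp
      (fun h => hψ (h.trans (map_zero ψ).symm)) fun h => hψ (h.trans (map_one ψ).symm)
  rcases isUnit_or_isUnit_one_sub_of_finite (R := R) hid (Ideal.Quotient.mk _ Polynomial.X)
    with h | h
  · left
    rw [← hb]
    exact h.map ψ
  · right
    rw [← hb, ← map_one ψ, ← map_sub]
    exact h.map ψ

theorem exists_isUnit_of_isUnit_sum {A ι : Type*} [Ring A] [IsLocalRing A] (s : Finset ι)
    (f : ι → A) (h : IsUnit (∑ i ∈ s, f i)) : ∃ i ∈ s, IsUnit (f i) := by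
  classical
  induction s using Finset.induction_on with
  | empty => simp at h
  | insert a s ha ih =>
    rw [Finset.sum_insert ha] at h
    obtain ⟨u, hu⟩ := h
    have h1 : (↑u⁻¹ * f a) + ↑u⁻¹ * ∑ i ∈ s, f i = 1 := by
      rw [← mul_add, ← hu, Units.inv_mul]
    rcases IsLocalRing.isUnit_or_isUnit_of_add_one h1 with h | h
    · exact ⟨a, by simp, by simpa using h⟩
    · obtain ⟨i, hi, h⟩ := ih (by simpa using h)
      exact ⟨i, by simp [hi], h⟩

variable {R : Type*} [CommRing R]

theorem isSummand_of_isUnit {M T : Type*} [AddCommGroup M] [Module R M] [AddCommGroup T]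
    [Module R T] (i : M →ₗ[R] T) (r : T →ₗ[R] M) (h : IsUnit (r ∘ₗ i : Module.End R M)) :
    IsSummand R M T := by
  obtain ⟨u, hu⟩ := h
  refine ⟨i, (↑u⁻¹ : Module.End R M) ∘ₗ r, ?_⟩
  rw [LinearMap.comp_assoc, ← hu]
  exact u.inv_mul

/-- The identity of `M` is a sum of endomorphisms factoring through the single copies of `T`; in a
local ring one of them is a unit. -/
theorem isSummand_of_isSummand_pi {M T : Type*} [AddCommGroup M] [Module R M]
    [IsLocalRing (Module.End R M)] [AddCommGroup T] [Module R T] {n : ℕ}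
    (h : IsSummand R M (Fin n → T)) : IsSummand R M T := by
  obtain ⟨i, r, hr⟩ := h
  have h1 : ∑ j : Fin n, ((r ∘ₗ LinearMap.single R _ j) ∘ₗ (LinearMap.proj j ∘ₗ i) :
      Module.End R M) = 1 := by
    ext m
    rw [LinearMap.sum_apply]
    simp only [LinearMap.comp_apply, LinearMap.single_apply, LinearMap.proj_apply]
    rw [← map_sum, Finset.univ_sum_single]
    exact LinearMap.congr_fun hr m
  obtain ⟨j, -, hj⟩ := exists_isUnit_of_isUnit_sum _ _ (h1 ▸ isUnit_one)
  exact isSummand_of_isUnit _ _ hj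

theorem isSummand_or_isSummand_of_isCompl {M T : Type*} [AddCommGroup M] [Module R M]
    [IsLocalRing (Module.End R M)] [AddCommGroup T] [Module R T] {N N' : Submodule R T}
    (hN : IsCompl N N') (h : IsSummand R M T) : IsSummand R M N ∨ IsSummand R M N' := by
  obtain ⟨i, r, hr⟩ := h
  have h1 : ((r ∘ₗ N.subtype) ∘ₗ (N.projectionOnto N' hN ∘ₗ i) : Module.End R M) +
      ((r ∘ₗ N'.subtype) ∘ₗ (N'.projectionOnto N hN.symm ∘ₗ i) : Module.End R M) = 1 := by
    ext m
    have := Submodule.projection_add_projection_eq_self hN (i m)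
    have h2 := congrArg r this
    rw [map_add] at h2
    exact h2.trans (LinearMap.congr_fun hr m)
  exact (IsLocalRing.isUnit_or_isUnit_of_add_one h1).imp (isSummand_of_isUnit _ _)
    (isSummand_of_isUnit _ _)

theorem IsSummand.nonempty_equiv {M N : Type*} [AddCommGroup M] [Module R M] [Nontrivial M]
    [AddCommGroup N] [Module R N] (h : IsSummand R M N) (hN : IsIndecomposable R N) :
    Nonempty (M ≃ₗ[R] N) := by
  obtain ⟨i, r, hr⟩ := h
  have hr' : ∀ m, r (i m) = m := LinearMap.congr_fun hr
  rcases isIdempotentElem_eq_zero_or_one hN (i ∘ₗ r) (by ext n; simp [hr']) with h | h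
  · obtain ⟨m, hm⟩ := exists_ne (0 : M)
    refine (hm ?_).elim
    have := LinearMap.congr_fun h (i m)
    simp only [LinearMap.comp_apply, hr', LinearMap.zero_apply] at this
    rw [← hr' m, this, map_zero]
  · exact ⟨LinearEquiv.ofLinearMap i r h hr⟩

end LocalEndomorphisms

/-! ### Finiteness of the set of summands. -/

section FinitelyManySummands

variable {R : Type u} [CommRing R] (T : Type u) [AddCommGroup T] [Module R T] [IsNoetherian R T]

/-- Noetherian induction on `W`. If `T ⧸ W` decomposes, each factor is a quotient of `T` by a
strictly larger submodule, and a summand with local endomorphism ring is a summand of one factor. -/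
theorem exists_finite_summands_quotient (W : Submodule R T) :
    ∃ L : Set (ModuleCat.{u} R), L.Finite ∧ ∀ M : ModuleCat.{u} R,
      IsLocalRing (Module.End R M) → IsSummand R M (T ⧸ W) → ∃ N ∈ L, Nonempty (M ≅ N) := by
  induction W using IsNoetherian.induction with
  | hgt W ih =>
  by_cases hQ : Subsingleton (T ⧸ W)
  · refine ⟨∅, Set.finite_empty, fun M hM ⟨i, r, hr⟩ => ?_⟩
    refine (one_ne_zero (α := Module.End R M) ?_).elim
    ext m
    have := LinearMap.congr_fun hr m
    rw [LinearMap.comp_apply, Subsingleton.elim (i m) 0, map_zero] at this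
    exact this.symm
  rw [not_subsingleton_iff_nontrivial] at hQ
  by_cases hind : IsIndecomposable R (T ⧸ W)
  · refine ⟨{ModuleCat.of R (T ⧸ W)}, Set.finite_singleton _, fun M hM h => ⟨_, rfl, ?_⟩⟩
    have : Nontrivial M := by
      by_contra hn
      rw [not_nontrivial_iff_subsingleton] at hn
      exact one_ne_zero (α := Module.End R M) (LinearMap.ext fun m => Subsingleton.elim _ _)
    obtain ⟨e⟩ := h.nonempty_equiv hind
    exact ⟨e.toModuleIso⟩
  · simp only [IsIndecomposable, hQ, true_and, not_forall, not_or] at hind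
    obtain ⟨N, N', hN, h1, h2⟩ := hind
    have key : ∀ N : Submodule R (T ⧸ W), N ≠ ⊥ → W < LinearMap.ker (N.mkQ ∘ₗ W.mkQ) := by
      intro N hN
      refine lt_of_le_of_ne (fun w hw => ?_) fun h => hN ?_
      · have : W.mkQ w = 0 := by simpa using hw
        simp only [LinearMap.mem_ker, LinearMap.comp_apply, this, map_zero]
      · rw [eq_bot_iff]
        intro q hq
        obtain ⟨t, rfl⟩ := W.mkQ_surjective q
        have : t ∈ W := by
          rw [h, LinearMap.mem_ker, LinearMap.comp_apply, Submodule.mkQ_apply N,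
            Submodule.Quotient.mk_eq_zero]
          exact hq
        simpa using this
    have heq : ∀ N N' : Submodule R (T ⧸ W), IsCompl N N' →
        Nonempty (N' ≃ₗ[R] T ⧸ LinearMap.ker (N.mkQ ∘ₗ W.mkQ)) := fun N N' h =>
      ⟨(Submodule.quotientEquivOfIsCompl N N' h).symm.trans
        (LinearMap.quotKerEquivOfSurjective (N.mkQ ∘ₗ W.mkQ)
          (N.mkQ_surjective.comp W.mkQ_surjective)).symm⟩
    obtain ⟨L₁, hL₁, H₁⟩ := ih _ (key N h1)
    obtain ⟨L₂, hL₂, H₂⟩ := ih _ (key N' h2)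
    obtain ⟨e₁⟩ := heq N N' hN
    obtain ⟨e₂⟩ := heq N' N hN.symm
    refine ⟨L₁ ∪ L₂, hL₁.union hL₂, fun M hM h => ?_⟩
    rcases isSummand_or_isSummand_of_isCompl hN h with h | h
    · obtain ⟨P, hP, hMP⟩ := H₂ M hM (h.trans (isSummand_of_equiv e₂))
      exact ⟨P, .inr hP, hMP⟩
    · obtain ⟨P, hP, hMP⟩ := H₁ M hM (h.trans (isSummand_of_equiv e₁))
      exact ⟨P, .inl hP, hMP⟩

/-- A noetherian module has, up to isomorphism, only finitely many summands with local endomorphism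
ring. -/
theorem exists_finite_summands :
    ∃ L : Set (ModuleCat.{u} R), L.Finite ∧ ∀ M : ModuleCat.{u} R,
      IsLocalRing (Module.End R M) → IsSummand R M T → ∃ N ∈ L, Nonempty (M ≅ N) := by
  obtain ⟨L, hL, H⟩ := exists_finite_summands_quotient (R := R) T ⊥
  exact ⟨L, hL, fun M hM h =>
    H M hM (h.trans (isSummand_of_equiv (Submodule.quotEquivOfEqBot ⊥ rfl).symm))⟩

end FinitelyManySummands

/-! ### Integrals on the coordinate Hopf algebra. -/

section Integrals

variable {k : Type u} [Field k] {A : Type v} [CommRing A] [HopfAlgebra k A]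

theorem isCoaction_comul : IsCoaction (Coalgebra.comul (R := k) (A := A)) where
  coassoc := Coalgebra.coassoc
  counit := by
    ext a
    simp

theorem IsCoaction.congr {V : Type*} {W : Type*} [AddCommGroup V] [Module k V] [AddCommGroup W]
    [Module k W] {δ : V →ₗ[k] V ⊗[k] A} (h : IsCoaction δ) (e : V ≃ₗ[k] W) :
    IsCoaction (e.toLinearMap.rTensor A ∘ₗ δ ∘ₗ e.symm.toLinearMap) where
  coassoc := by
    have h1 : (TensorProduct.assoc k W A A).toLinearMap ∘ₗ (e.toLinearMap.rTensor A).rTensor A =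
        e.toLinearMap.rTensor (A ⊗[k] A) ∘ₗ (TensorProduct.assoc k V A A).toLinearMap := by
      ext; simp
    have h2 : e.symm.toLinearMap.rTensor A ∘ₗ e.toLinearMap.rTensor A = LinearMap.id := by
      ext; simp
    have h3 : (Coalgebra.comul (R := k) (A := A)).lTensor W ∘ₗ e.toLinearMap.rTensor A =
        e.toLinearMap.rTensor (A ⊗[k] A) ∘ₗ (Coalgebra.comul (R := k) (A := A)).lTensor V := by
      ext; simp
    ext w
    have h1' := fun x => LinearMap.congr_fun h1 x
    have h2' := fun x => LinearMap.congr_fun h2 x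
    have h3' := fun x => LinearMap.congr_fun h3 x
    have h4 := LinearMap.congr_fun h.coassoc (e.symm w)
    simp only [LinearMap.comp_apply, LinearMap.rTensor_comp, LinearMap.id_apply,
      LinearEquiv.coe_coe] at h1' h2' h3' h4 ⊢
    rw [h2', h1', h4, h3']
  counit := by
    have h1 : (TensorProduct.rid k W).toLinearMap ∘ₗ (Coalgebra.counit (R := k) (A := A)).lTensor W ∘ₗ
        e.toLinearMap.rTensor A = e.toLinearMap ∘ₗ (TensorProduct.rid k V).toLinearMap ∘ₗ
          (Coalgebra.counit (R := k) (A := A)).lTensor V := by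
      ext; simp
    ext w
    have h1' := LinearMap.congr_fun h1 (δ (e.symm w))
    have h4 := LinearMap.congr_fun h.counit (e.symm w)
    simp only [LinearMap.comp_apply, LinearMap.id_apply, LinearEquiv.coe_coe] at h1' h4 ⊢
    rw [h1', h4, e.apply_symm_apply]

theorem IsSubrep.rTensor_eq_zero {V : Type*} [AddCommGroup V] [Module k V] {δ : V →ₗ[k] V ⊗[k] A}
    {W : Submodule k V} (h : IsSubrep δ W) (f : V →ₗ[k] k) (hf : ∀ w ∈ W, f w = 0) {w : V}
    (hw : w ∈ W) : f.rTensor A (δ w) = 0 := by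
  obtain ⟨t, ht⟩ := h w hw
  have : f ∘ₗ W.subtype = 0 := by
    ext x
    exact hf x x.2
  rw [← ht, ← LinearMap.comp_apply, ← LinearMap.rTensor_comp, this, LinearMap.rTensor_zero,
    LinearMap.zero_apply]

/-- A linearly reductive finite group scheme has a normalized integral. -/
theorem IsLinearlyReductive.exists_integral [Module.Finite k A] (hG : IsLinearlyReductive k A) :
    ∃ l : A →ₗ[k] k, l 1 = 1 ∧
      ∀ a, TensorProduct.lid k A (l.rTensor A (Coalgebra.comul a)) = l a • 1 := by
  -- The regular representation is transported to `kⁿ`, which lives in the universe of `k`. An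
  -- invariant complement of the line through `1` then gives the invariant functional `f`.
  let e := (Module.finBasis k A).equivFun
  let V := Fin (Module.finrank k A) → k
  let δ := e.toLinearMap.rTensor A ∘ₗ Coalgebra.comul ∘ₗ e.symm.toLinearMap
  have hδ : ∀ a, δ (e a) = e.toLinearMap.rTensor A (Coalgebra.comul a) := fun a => by simp [δ]
  have hδ1 : δ (e 1) = e 1 ⊗ₜ 1 := by
    rw [hδ, Bialgebra.comul_one, Algebra.TensorProduct.one_def]
    rfl
  have hne : e 1 ≠ 0 := by
    intro h
    have h1 : (1 : A) = 0 := by simpa using h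
    have := congrArg (Coalgebra.counit (R := k)) h1
    simp at this
  let W : Submodule k V := k ∙ (e 1)
  have hmem : e 1 ∈ W := Submodule.mem_span_singleton_self _
  have hW : IsSubrep δ W := by
    intro x hx
    obtain ⟨c, rfl⟩ := Submodule.mem_span_singleton.1 hx
    rw [map_smul]
    refine Submodule.smul_mem _ _ ⟨⟨e 1, hmem⟩ ⊗ₜ 1, ?_⟩
    rw [hδ1]
    rfl
  obtain ⟨W', hW', hc⟩ := hG V δ (isCoaction_comul.congr e) W hW
  let f : V →ₗ[k] k := (LinearEquiv.toSpanNonzeroSingleton k V (e 1) hne).symm.toLinearMap ∘ₗ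
    W.projectionOnto W' hc
  have hf1 : f (e 1) = 1 := by
    have : W.projectionOnto W' hc (e 1) = ⟨e 1, hmem⟩ :=
      Submodule.projectionOnto_apply_left hc ⟨e 1, hmem⟩
    simp only [f, LinearMap.comp_apply, this, LinearEquiv.coe_coe]
    rw [LinearEquiv.symm_apply_eq]
    ext1
    simp
  have hf0 : ∀ w ∈ W', f w = 0 := by
    intro w hw
    simp only [f, LinearMap.comp_apply]
    rw [(Submodule.projectionOnto_apply_eq_zero_iff hc).2 hw, map_zero]
  have key : ∀ v, f.rTensor A (δ v) = f v ⊗ₜ 1 := by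
    intro v
    obtain ⟨w, hw, w', hw', rfl⟩ := Submodule.mem_sup.1
      (show v ∈ W ⊔ W' by rw [hc.sup_eq_top]; trivial)
    obtain ⟨c, rfl⟩ := Submodule.mem_span_singleton.1 hw
    rw [map_add, map_add, map_add, hW'.rTensor_eq_zero f hf0 hw', hf0 _ hw', add_zero, add_zero,
      map_smul, map_smul, hδ1, map_smul, LinearMap.rTensor_tmul, hf1, TensorProduct.smul_tmul']
  refine ⟨f ∘ₗ e.toLinearMap, hf1, fun a => ?_⟩
  have := key (e a)
  rw [hδ] at this
  rw [LinearMap.rTensor_comp, LinearMap.comp_apply, this, TensorProduct.lid_tmul]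
  rfl

open WithConv Coalgebra

theorem antipode_antipode_apply (a : A) :
    HopfAlgebra.antipode k (HopfAlgebra.antipode k a) = a := by
  have := inv_inv (toConv (AlgHom.id k A))
  exact DFunLike.congr_fun (congrArg ofConv this) a

/-- Algebra maps out of `A` form a group under convolution, with inversion by the antipode.
Inverting this factorization, or cancelling its left factor, gives the two antipode identities
below. -/
theorem includeLeft_mul_includeRight_conv :
    (toConv (Algebra.TensorProduct.includeLeft : A →ₐ[k] A ⊗[k] A)) *
      toConv Algebra.TensorProduct.includeRight = toConv (Bialgebra.comulAlgHom k A) := by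
  apply WithConv.ext
  ext a
  change ((toConv (Algebra.TensorProduct.includeLeft : A →ₐ[k] A ⊗[k] A)) *
      toConv Algebra.TensorProduct.includeRight : WithConv (A →ₐ[k] A ⊗[k] A)) a = _
  rw [AlgHom.convMul_apply]
  have : Algebra.TensorProduct.lift (Algebra.TensorProduct.includeLeft : A →ₐ[k] A ⊗[k] A)
      Algebra.TensorProduct.includeRight (fun _ _ => .all ..) = AlgHom.id k _ := by
    ext <;> simp
  exact DFunLike.congr_fun this _

/-- The antipode is an antihomomorphism of coalgebras. -/
theorem comul_antipode (a : A) :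
    Coalgebra.comul (R := k) (HopfAlgebra.antipode k a) =
      TensorProduct.comm k A A (TensorProduct.map (HopfAlgebra.antipode k) (HopfAlgebra.antipode k)
        (Coalgebra.comul a)) := by
  have h := congrArg (fun f => f⁻¹) (includeLeft_mul_includeRight_conv (k := k) (A := A))
  replace h := (mul_inv_rev (toConv (Algebra.TensorProduct.includeLeft : A →ₐ[k] A ⊗[k] A))
    (toConv Algebra.TensorProduct.includeRight)).symm.trans h
  have h1 := congrArg (fun f : WithConv (A →ₐ[k] A ⊗[k] A) => f.ofConv a) h
  replace h1 := (AlgHom.convMul_apply _ _ a).symm.trans h1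
  refine h1.symm.trans ?_
  induction Coalgebra.comul (R := k) a with
  | zero => simp
  | add x y hx hy => simp only [map_add, hx, hy]
  | tmul x y =>
    change (1 ⊗ₜ[k] HopfAlgebra.antipode k x) * (HopfAlgebra.antipode k y ⊗ₜ[k] 1) = _
    simp

/-- The convolution identity `∑ S(b₁) b₂ ⊗ b₃ = 1 ⊗ b`. -/
theorem sum_antipode_tmul_one_mul_comul {b : A} {ι : Type*}
    (r : Coalgebra.Repr k b ι) :
    ∑ i ∈ r.index, (HopfAlgebra.antipode k (r.left i) ⊗ₜ[k] 1) * Coalgebra.comul (r.right i) =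
      1 ⊗ₜ[k] b := by
  have h := congrArg (fun f => (toConv (Algebra.TensorProduct.includeLeft : A →ₐ[k] A ⊗[k] A))⁻¹ * f)
    (includeLeft_mul_includeRight_conv (k := k) (A := A))
  replace h := (inv_mul_cancel_left
    (toConv (Algebra.TensorProduct.includeLeft : A →ₐ[k] A ⊗[k] A))
    (toConv Algebra.TensorProduct.includeRight)).symm.trans h
  have h1 := congrArg (fun f : WithConv (A →ₐ[k] A ⊗[k] A) => f.ofConv b) h
  replace h1 := h1.trans (AlgHom.convMul_apply _ _ b)
  rw [← r.eq, map_sum] at h1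
  exact h1.symm

/-- A linearly reductive finite group scheme has a normalized integral on the other side. -/
theorem IsLinearlyReductive.exists_right_integral [Module.Finite k A]
    (hG : IsLinearlyReductive k A) :
    ∃ l : A →ₗ[k] k, l 1 = 1 ∧
      ∀ a, TensorProduct.rid k A (l.lTensor A (Coalgebra.comul a)) = l a • 1 := by
  obtain ⟨l, hl1, hl⟩ := hG.exists_integral
  refine ⟨l ∘ₗ HopfAlgebra.antipode k, by simpa using hl1, fun a => ?_⟩
  have h := congrArg (HopfAlgebra.antipode k) (hl (HopfAlgebra.antipode k a))
  rw [comul_antipode, map_smul, HopfAlgebra.antipode_one] at h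
  rw [LinearMap.comp_apply, ← h]
  induction Coalgebra.comul (R := k) a with
  | zero => simp
  | add x y hx hy => simp only [map_add, hx, hy]
  | tmul x y => simp [antipode_antipode_apply]

/-- The form `(a, b) ↦ l (a * b)` defined by a normalized integral `l` is nondegenerate. -/
theorem eq_zero_of_integral_mul_eq_zero {l : A →ₗ[k] k} (hl1 : l 1 = 1)
    (hl : ∀ a, TensorProduct.rid k A (l.lTensor A (Coalgebra.comul a)) = l a • 1) {a : A}
    (ha : ∀ b, l (a * b) = 0) : a = 0 := by
  let L : A ⊗[k] A →ₗ[k] A := (TensorProduct.rid k A).toLinearMap ∘ₗ l.lTensor A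
  have hL : ∀ c x, L ((c ⊗ₜ 1) * x) = c * L x := by
    intro c x
    induction x with
    | zero => simp
    | add x y hx hy => simp only [map_add, mul_add, hx, hy]
    | tmul x y => simp [L]
  -- In Sweedler notation, `∑ a₁ l(a₂ b) = ∑ S(b₁) l(a b₂)`, with `S` the antipode; the right side
  -- vanishes for `a` in the radical of the form.
  have h1 : ∀ a, (∀ b, l (a * b) = 0) → ∀ b, L (Coalgebra.comul a * (1 ⊗ₜ b)) = 0 := by
    intro a ha b
    rw [← sum_antipode_tmul_one_mul_comul (ℛ k b), Finset.mul_sum, map_sum]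
    refine Finset.sum_eq_zero fun i _ => ?_
    rw [mul_left_comm, hL, ← Bialgebra.comul_mul]
    have := hl (a * (ℛ k b).right i)
    rw [ha, zero_smul] at this
    exact mul_eq_zero_of_right _ this
  let B := Module.Free.chooseBasis k A
  -- Hence the comultiplication maps the radical `N` of the form into `A ⊗ N`.
  have h2 : ∀ a, (∀ b, l (a * b) = 0) → ∃ m : Module.Free.ChooseBasisIndex k A →₀ A,
      (m.sum fun i x => B i ⊗ₜ[k] x) = Coalgebra.comul a ∧ ∀ i b, l (m i * b) = 0 := by
    intro a ha
    obtain ⟨m, hm⟩ := TensorProduct.eq_repr_basis_left B (Coalgebra.comul (R := k) a)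
    refine ⟨m, hm, fun i b => ?_⟩
    have := h1 a ha b
    rw [← hm, Finsupp.sum, Finset.sum_mul, map_sum] at this
    simp only [L, Algebra.TensorProduct.tmul_mul_tmul, mul_one, LinearMap.comp_apply,
      LinearMap.lTensor_tmul, LinearEquiv.coe_coe, TensorProduct.rid_tmul] at this
    by_cases hi : i ∈ m.support
    · exact linearIndependent_iff'.1 B.linearIndependent m.support (fun i => l (m i * b)) this i hi
    · rw [Finsupp.notMem_support_iff.1 hi, zero_mul, map_zero]
  -- Applying `l` to `∑ S(a₁) a₂ = ε(a)` shows that the counit kills the radical. Then `a = ∑ a₁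
  -- ε(a₂)` forces `a = 0`.
  have h3 : ∀ a, (∀ b, l (a * b) = 0) → Coalgebra.counit (R := k) a = 0 := by
    intro a ha
    obtain ⟨m, hm, hm'⟩ := h2 a ha
    have := HopfAlgebra.mul_antipode_rTensor_comul_apply (R := k) a
    rw [← hm, Finsupp.sum, map_sum, map_sum] at this
    have h4 := congrArg l this
    rw [map_sum, Algebra.algebraMap_eq_smul_one, map_smul, hl1, smul_eq_mul, mul_one] at h4
    rw [← h4]
    refine Finset.sum_eq_zero fun i _ => ?_
    rw [LinearMap.rTensor_tmul, LinearMap.mul'_apply, mul_comm]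
    exact hm' i _
  obtain ⟨m, hm, hm'⟩ := h2 a ha
  have := Coalgebra.lTensor_counit_comul (R := k) a
  rw [← hm, Finsupp.sum, map_sum, Finset.sum_eq_zero fun i _ => by
    rw [LinearMap.lTensor_tmul, h3 _ (hm' i), TensorProduct.tmul_zero]] at this
  simpa using (congrArg (TensorProduct.rid k A) this).symm

/-- A normalized integral has a dual integral element. -/
theorem exists_integral_element [Module.Finite k A] {l : A →ₗ[k] k} (hl1 : l 1 = 1)
    (hl : ∀ a, TensorProduct.rid k A (l.lTensor A (Coalgebra.comul a)) = l a • 1) :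
    ∃ c : A, l c = 1 ∧ ∀ a, a * c = Coalgebra.counit (R := k) a • c := by
  let F : A →ₗ[k] Module.Dual k A := (LinearMap.mul k A).compr₂ l
  have hF : Function.Injective F := by
    rw [injective_iff_map_eq_zero]
    intro a ha
    exact eq_zero_of_integral_mul_eq_zero hl1 hl fun b => LinearMap.congr_fun ha b
  -- The element `c` represents the counit under the nondegenerate form: `l (c * b) = ε b`.
  obtain ⟨c, hc⟩ := (LinearMap.injective_iff_surjective_of_finrank_eq_finrank
    (Subspace.dual_finrank_eq (K := k) (V := A)).symm).1 hF (Coalgebra.counit (R := k))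
  have hc' : ∀ b, l (c * b) = Coalgebra.counit (R := k) b := LinearMap.congr_fun hc
  refine ⟨c, by simpa using hc' 1, fun a => hF ?_⟩
  ext b
  change l (a * c * b) = l (Coalgebra.counit (R := k) a • c * b)
  rw [smul_mul_assoc, map_smul, hc', mul_assoc, mul_left_comm, hc', Bialgebra.counit_mul,
    smul_eq_mul]

end Integrals

/-! ### The Reynolds operator, finiteness over the invariants and the trace form. -/

section Reynolds

variable {k : Type u} [Field k] {A : Type v} [CommRing A] [HopfAlgebra k A]
variable {S : Type w} [CommRing S] [Algebra k S]

/-- The `S`-linear extension `S ⊗ A → S` of a functional on `A`. -/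
noncomputable def integrate (S : Type w) [CommRing S] [Algebra k S] (l : A →ₗ[k] k) :
    S ⊗[k] A →ₗ[S] S :=
  (TensorProduct.AlgebraTensorModule.rid k S S).toLinearMap ∘ₗ l.baseChange S

@[simp]
theorem integrate_tmul (l : A →ₗ[k] k) (s : S) (a : A) : integrate S l (s ⊗ₜ a) = l a • s := by
  simp [integrate]

theorem integrate_tmul_one_mul (l : A →ₗ[k] k) (s : S) (t : S ⊗[k] A) :
    integrate S l ((s ⊗ₜ 1) * t) = s * integrate S l t := by
  have : (s ⊗ₜ 1) * t = s • t := by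
    rw [Algebra.smul_def]
    rfl
  rw [this, map_smul, smul_eq_mul]

/-- Apply `l` to the last factor of the coassociativity identity and use invariance of `l` on the
right-hand side. -/
theorem IsAction.integrate_tmul_one {ρ : S →ₐ[k] S ⊗[k] A} (hρ : IsAction ρ) {l : A →ₗ[k] k}
    (hl : ∀ a, TensorProduct.rid k A (l.lTensor A (Coalgebra.comul a)) = l a • 1) (s : S) :
    ρ (integrate S l (ρ s)) = integrate S l (ρ s) ⊗ₜ 1 := by
  let f : S ⊗[k] (A ⊗[k] A) →ₗ[k] S ⊗[k] A :=
    ((TensorProduct.rid k A).toLinearMap ∘ₗ l.lTensor A).lTensor S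
  have h := congrArg f (LinearMap.congr_fun hρ.coassoc s)
  simp only [LinearMap.comp_apply, LinearEquiv.coe_coe, AlgHom.toLinearMap_apply] at h
  have h1 : ∀ t : S ⊗[k] A, f (TensorProduct.assoc k S A A (ρ.toLinearMap.rTensor A t)) =
      ρ (integrate S l t) := by
    intro t
    induction t with
    | zero => simp
    | add x y hx hy => simp only [map_add, hx, hy]
    | tmul x a =>
      rw [LinearMap.rTensor_tmul, AlgHom.toLinearMap_apply, integrate_tmul, map_smul]
      induction ρ x with
      | zero => simp
      | add x y hx hy => simp only [map_add, TensorProduct.add_tmul, hx, hy, smul_add]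
      | tmul x b => simp [f]
  have h2 : ∀ t : S ⊗[k] A, f ((Coalgebra.comul (R := k) (A := A)).lTensor S t) =
      integrate S l t ⊗ₜ 1 := by
    intro t
    induction t with
    | zero => simp
    | add x y hx hy => simp only [map_add, TensorProduct.add_tmul, hx, hy]
    | tmul x a =>
      rw [LinearMap.lTensor_tmul, integrate_tmul, TensorProduct.smul_tmul, ← hl]
      rfl
  rw [← h1, ← h2, h]

/-- The Reynolds operator `S → S^G` defined by an integral. -/
noncomputable def reynolds {ρ : S →ₐ[k] S ⊗[k] A} (hρ : IsAction ρ) {l : A →ₗ[k] k}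
    (hl : ∀ a, TensorProduct.rid k A (l.lTensor A (Coalgebra.comul a)) = l a • 1) :
    S →ₗ[invariants ρ] invariants ρ where
  toFun s := ⟨integrate S l (ρ s), hρ.integrate_tmul_one hl s⟩
  map_add' s t := Subtype.ext (by simp)
  map_smul' r s := Subtype.ext (by
    have : ρ (r : S) = (r : S) ⊗ₜ 1 := r.2
    change integrate S l (ρ ((r : S) * s)) = (r : S) * integrate S l (ρ s)
    rw [map_mul, this, integrate_tmul_one_mul])

theorem coe_reynolds {ρ : S →ₐ[k] S ⊗[k] A} (hρ : IsAction ρ) {l : A →ₗ[k] k}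
    (hl : ∀ a, TensorProduct.rid k A (l.lTensor A (Coalgebra.comul a)) = l a • 1) (s : S) :
    (reynolds hρ hl s : S) = integrate S l (ρ s) := rfl

theorem reynolds_one {ρ : S →ₐ[k] S ⊗[k] A} (hρ : IsAction ρ) {l : A →ₗ[k] k}
    (hl1 : l 1 = 1)
    (hl : ∀ a, TensorProduct.rid k A (l.lTensor A (Coalgebra.comul a)) = l a • 1) :
    reynolds hρ hl 1 = 1 := by
  apply Subtype.ext
  rw [coe_reynolds, map_one, Algebra.TensorProduct.one_def, integrate_tmul, hl1, one_smul]
  rfl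

/-- The algebra map `S ⊗ A → S ⊗ A`, `s ⊗ a ↦ ρ s * (1 ⊗ antipode a)`. -/
noncomputable def untwist (ρ : S →ₐ[k] S ⊗[k] A) : S ⊗[k] A →ₐ[k] S ⊗[k] A :=
  Algebra.TensorProduct.productMap ρ
    (Algebra.TensorProduct.includeRight.comp (HopfAlgebra.antipodeAlgHom k A))

theorem untwist_tmul (ρ : S →ₐ[k] S ⊗[k] A) (s : S) (a : A) :
    untwist ρ (s ⊗ₜ a) = ρ s * (1 ⊗ₜ HopfAlgebra.antipode k a) := rfl

/-- By coassociativity the left side is `∑ s₀ ⊗ s₁ S(s₂)`, with `S` the antipode, and this collapses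
by the antipode and counit axioms. -/
theorem IsAction.untwist_apply {ρ : S →ₐ[k] S ⊗[k] A} (hρ : IsAction ρ) (s : S) :
    untwist ρ (ρ s) = s ⊗ₜ 1 := by
  let f : S ⊗[k] (A ⊗[k] A) →ₗ[k] S ⊗[k] A :=
    (LinearMap.mul' k A ∘ₗ (HopfAlgebra.antipode k).lTensor A).lTensor S
  have h := congrArg f (LinearMap.congr_fun hρ.coassoc s)
  simp only [LinearMap.comp_apply, LinearEquiv.coe_coe, AlgHom.toLinearMap_apply] at h
  have h1 : ∀ t : S ⊗[k] A, f (TensorProduct.assoc k S A A (ρ.toLinearMap.rTensor A t)) =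
      untwist ρ t := by
    intro t
    induction t with
    | zero => simp
    | add x y hx hy => simp only [map_add, hx, hy]
    | tmul x a =>
      rw [LinearMap.rTensor_tmul, AlgHom.toLinearMap_apply, untwist_tmul]
      induction ρ x with
      | zero => simp
      | add x y hx hy => simp only [map_add, TensorProduct.add_tmul, hx, hy, add_mul]
      | tmul x b => simp [f]
  have h2 : ∀ t : S ⊗[k] A, f ((Coalgebra.comul (R := k) (A := A)).lTensor S t) =
      TensorProduct.rid k S ((Coalgebra.counit (R := k) (A := A)).lTensor S t) ⊗ₜ 1 := by
    intro t
    induction t with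
    | zero => simp
    | add x y hx hy => simp only [map_add, TensorProduct.add_tmul, hx, hy]
    | tmul x a =>
      simp only [f, LinearMap.lTensor_tmul, LinearMap.comp_apply,
        HopfAlgebra.mul_antipode_lTensor_comul_apply, TensorProduct.rid_tmul,
        TensorProduct.smul_tmul, Algebra.algebraMap_eq_smul_one]
  rw [← h1, h, h2]
  exact congrArg (· ⊗ₜ[k] (1 : A)) (LinearMap.congr_fun hρ.counit s)

theorem integrate_untwist {ρ : S →ₐ[k] S ⊗[k] A} (hρ : IsAction ρ) {l : A →ₗ[k] k}
    (hl : ∀ a, TensorProduct.rid k A (l.lTensor A (Coalgebra.comul a)) = l a • 1) (s n : S) :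
    integrate S l (untwist ρ (s • ρ n)) = reynolds hρ hl s • n := by
  have : s • ρ n = (s ⊗ₜ 1) * ρ n := by
    rw [Algebra.smul_def]
    rfl
  rw [this, map_mul, hρ.untwist_apply, untwist_tmul, HopfAlgebra.antipode_one,
    ← Algebra.TensorProduct.one_def, mul_one, mul_comm, integrate_tmul_one_mul, mul_comm]
  rfl

/-- If `S` is noetherian, then it is a noetherian module over the invariants. -/
theorem isNoetherian_invariants [Module.Finite k A] [IsNoetherianRing S] {ρ : S →ₐ[k] S ⊗[k] A}
    (hρ : IsAction ρ) {l : A →ₗ[k] k} (hl1 : l 1 = 1)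
    (hl : ∀ a, TensorProduct.rid k A (l.lTensor A (Coalgebra.comul a)) = l a • 1) :
    IsNoetherian (invariants ρ) S where
  noetherian N := by
    -- `S ⊗ A` is noetherian over `S`, so finitely many `ρ y` with `y ∈ N` span all of `ρ N`.
    -- Untwisting and integrating turns each `s • ρ y` into `E(s) • y`, so an `S`-combination for `ρ
    -- n` becomes an `R`-combination for `n`.
    obtain ⟨X, hX, hspan⟩ := (Submodule.fg_span_iff_fg_span_finset_subset (ρ '' (N : Set S))).1
      (IsNoetherian.noetherian (Submodule.span S (ρ '' (N : Set S))))
    classical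
    obtain ⟨Y, hY, rfl⟩ := Finset.subset_set_image_iff.1 hX
    refine ⟨Y, le_antisymm (Submodule.span_le.2 hY) fun n hn => ?_⟩
    have key : ∀ t ∈ Submodule.span S (ρ '' (Y : Set S)), ∀ s : S,
        integrate S l (untwist ρ (s • t)) ∈ Submodule.span (invariants ρ) (Y : Set S) := by
      intro t ht
      induction ht using Submodule.span_induction with
      | mem t ht =>
        obtain ⟨y, hy, rfl⟩ := ht
        intro s
        rw [integrate_untwist hρ hl]
        exact Submodule.smul_mem _ _ (Submodule.subset_span hy)
      | zero => simp
      | add x y _ _ hx hy =>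
        intro s
        rw [smul_add, map_add, map_add]
        exact add_mem (hx s) (hy s)
      | smul a x _ hx =>
        intro s
        rw [smul_smul]
        exact hx _
    have h := key (ρ n) (by
      have : ρ n ∈ Submodule.span S (ρ '' (N : Set S)) := Submodule.subset_span ⟨n, hn, rfl⟩
      rw [hspan] at this
      simpa using this) 1
    rwa [integrate_untwist hρ hl, reynolds_one hρ hl1 hl, one_smul] at h

/-- Over a prime where the Galois map is bijective, every functional on `S` is, up to a denominator,
of the form `b ↦ E (a * b)`, where `E` is the Reynolds operator. -/
theorem exists_smul_eq_reynolds_mul {ρ : S →ₐ[k] S ⊗[k] A} (hρ : IsAction ρ) {l : A →ₗ[k] k}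
    (hl : ∀ a, TensorProduct.rid k A (l.lTensor A (Coalgebra.comul a)) = l a • 1) {c : A}
    (hlc : l c = 1) (hc : ∀ a, a * c = Coalgebra.counit (R := k) a • c)
    (p : Ideal (invariants ρ)) [p.IsPrime]
    (hp : Function.Surjective (LocalizedModule.map p.primeCompl (galoisMap ρ).toLinearMap))
    (φ : S →ₗ[invariants ρ] invariants ρ) :
    ∃ s : invariants ρ, s ∉ p ∧ ∃ a : S, ∀ b, s * φ b = reynolds hρ hl (a * b) := by
  obtain ⟨x, hx⟩ := hp (LocalizedModule.mk (1 ⊗ₜ c) 1)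
  induction x using LocalizedModule.induction_on with
  | h z u =>
  rw [LocalizedModule.map_mk, LocalizedModule.mk_eq] at hx
  obtain ⟨v, hv⟩ := hx
  have hv' : galoisMap ρ ((v : invariants ρ) • z) =
      ((v : invariants ρ) * (u : invariants ρ)) • ((1 : S) ⊗ₜ[k] c) := by
    rw [map_smul, mul_smul]
    rw [one_smul] at hv
    exact hv
  set s : invariants ρ := (v : invariants ρ) * (u : invariants ρ) with hs
  refine ⟨s, mul_mem v.2 u.2, ?_⟩
  -- For `z = ∑ xᵢ ⊗ yᵢ` this produces the candidate `a = ∑ φ(xᵢ) yᵢ`. When `z` maps to `s (1 ⊗ c)`,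
  -- the integral on the left is `s b`, because `c` absorbs `A` through the counit and `l c = 1`.
  have h1 : ∀ z b, φ (integrate S l (galoisMap ρ z * ρ b)) = reynolds hρ hl
      (TensorProduct.lid (invariants ρ) S (φ.rTensor S z) * b) := by
    intro z b
    induction z with
    | zero => simp
    | add x y hx hy => simp only [map_add, add_mul, hx, hy]
    | tmul x y =>
      have : galoisMap ρ (x ⊗ₜ y) = (x ⊗ₜ 1) * ρ y := rfl
      rw [this, mul_assoc, ← map_mul, integrate_tmul_one_mul, ← coe_reynolds hρ hl,
        LinearMap.rTensor_tmul, TensorProduct.lid_tmul, smul_mul_assoc, map_smul]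
      have : x * (reynolds hρ hl (y * b) : S) = reynolds hρ hl (y * b) • x := mul_comm _ _
      rw [this, map_smul, smul_eq_mul, smul_eq_mul, mul_comm]
  have h2 : ∀ t : S ⊗[k] A, (1 ⊗ₜ c) * t =
      TensorProduct.rid k S ((Coalgebra.counit (R := k) (A := A)).lTensor S t) ⊗ₜ c := by
    intro t
    induction t with
    | zero => simp
    | add x y hx hy => simp only [map_add, TensorProduct.add_tmul, mul_add, hx, hy]
    | tmul x a =>
      rw [Algebra.TensorProduct.tmul_mul_tmul, one_mul, mul_comm, hc, LinearMap.lTensor_tmul,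
        TensorProduct.rid_tmul, TensorProduct.smul_tmul]
  refine ⟨TensorProduct.lid (invariants ρ) S (φ.rTensor S ((v : invariants ρ) • z)), fun b => ?_⟩
  rw [← h1, hv', smul_mul_assoc, h2]
  have h3 : TensorProduct.rid k S ((Coalgebra.counit (R := k) (A := A)).lTensor S (ρ b)) = b :=
    LinearMap.congr_fun hρ.counit b
  have h4 : s • (b ⊗ₜ[k] c) = (s • b) ⊗ₜ[k] c := rfl
  rw [h3, h4, integrate_tmul, hlc, one_smul, map_smul, smul_eq_mul]

end Reynolds

theorem isReflexive_pi {R M : Type*} [CommRing R] [AddCommGroup M] [Module R M]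
    [Module.IsReflexive R M] (n : ℕ) : Module.IsReflexive R (Fin n → M) := by
  induction n with
  | zero => infer_instance
  | succ n ih => exact Module.equiv (Fin.consLinearEquiv R fun _ : Fin (n + 1) => M)

/-! ### Descent along a retraction, and reflexivity of `S`. -/

section Retracts

variable {R S : Type*} [CommRing R] [CommRing S] [Algebra R S] 

theorem retraction_algebraMap (E : S →ₗ[R] R) (hE : E 1 = 1) (r : R) :
    E (algebraMap R S r) = r := by
  rw [Algebra.algebraMap_eq_smul_one, map_smul, hE, smul_eq_mul, mul_one]

theorem algebraMap_injective_of_retraction (E : S →ₗ[R] R) (hE : E 1 = 1) :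
    Function.Injective (algebraMap R S) :=
  Function.LeftInverse.injective (retraction_algebraMap E hE)

theorem isLocalHom_of_retraction (E : S →ₗ[R] R) (hE : E 1 = 1) : IsLocalHom (algebraMap R S) where
  map_nonunit r hr := by
    obtain ⟨s, hs⟩ := hr.exists_right_inv
    refine IsUnit.of_mul_eq_one (E s) ?_
    rw [← smul_eq_mul, ← map_smul, Algebra.smul_def, hs, hE]

theorem isNoetherianRing_of_retraction [IsNoetherian R S] (E : S →ₗ[R] R) (hE : E 1 = 1) :
    IsNoetherianRing R :=
  isNoetherian_of_injective (Algebra.linearMap R S) (algebraMap_injective_of_retraction E hE)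

theorem retraction_mem_of_mem_map (E : S →ₗ[R] R) (I : Ideal R) {s : S}
    (hs : s ∈ I.map (algebraMap R S)) : E s ∈ I := by
  rw [← Submodule.restrictScalars_mem R, ← Ideal.smul_top_eq_map] at hs
  induction hs using Submodule.smul_induction_on' with
  | smul r hr s _ =>
    rw [map_smul]
    exact I.mul_mem_right _ hr
  | add a _ b _ ha hb =>
    rw [map_add]
    exact add_mem ha hb

/-- A retract of a finite complete local extension is complete. -/
theorem isPrecomplete_of_retraction [IsLocalRing R] [IsLocalRing S] [IsNoetherianRing R]
    [Module.Finite R S] [IsPrecomplete (IsLocalRing.maximalIdeal S) S]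
    (E : S →ₗ[R] R) (hE : E 1 = 1) : IsPrecomplete (IsLocalRing.maximalIdeal R) R where
  prec' f hf := by
    have hloc := isLocalHom_of_retraction E hE
    have : IsNoetherianRing S := IsNoetherianRing.of_finite R S
    set m := IsLocalRing.maximalIdeal R
    set n := IsLocalRing.maximalIdeal S
    have hmn : m.map (algebraMap R S) ≤ n :=
      ((IsLocalRing.local_hom_TFAE (algebraMap R S)).out 0 2).1 hloc
    -- By integrality, every prime of `S` containing `mS` is maximal; so the two adic topologies on
    -- `S` agree and a limit can be taken in `S`, then pushed to `R` by `E`.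
    have hrad : n ≤ (m.map (algebraMap R S)).radical := by
      rw [Ideal.radical_eq_sInf]
      refine le_sInf fun q ⟨hq, hqp⟩ => ?_
      have h1 : m ≤ q.comap (algebraMap R S) := Ideal.map_le_iff_le_comap.1 hq
      have h2 : m = q.comap (algebraMap R S) :=
        (IsLocalRing.maximalIdeal.isMaximal R).eq_of_le (Ideal.IsPrime.ne_top inferInstance) h1
      have h3 : q.IsMaximal := Ideal.isMaximal_of_isIntegral_of_isMaximal_comap (R := R) q
        (h2 ▸ IsLocalRing.maximalIdeal.isMaximal R)
      exact (IsLocalRing.eq_maximalIdeal h3).ge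
    obtain ⟨N, hN⟩ := Ideal.exists_pow_le_of_le_radical_of_fg hrad (IsNoetherian.noetherian n)
    simp only [smul_eq_mul, Ideal.mul_top, SModEq.sub_mem] at hf ⊢
    obtain ⟨L, hL⟩ := IsPrecomplete.prec (I := n) inferInstance (f := fun j => algebraMap R S (f j))
      (fun {i j} hij => by
        rw [SModEq.sub_mem, ← map_sub, smul_eq_mul, Ideal.mul_top]
        refine Ideal.pow_right_mono hmn i ?_
        rw [← Ideal.map_pow]
        exact Ideal.mem_map_of_mem _ (hf hij))
    simp only [smul_eq_mul, Ideal.mul_top, SModEq.sub_mem] at hL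
    refine ⟨E L, fun i => ?_⟩
    rw [← retraction_algebraMap E hE (f i), ← map_sub]
    apply retraction_mem_of_mem_map
    -- Since `n ^ N ≤ mS`, convergence modulo `n ^ (N * i)` gives convergence modulo `(mS) ^ i`.
    rw [← sub_add_sub_cancel _ (algebraMap R S (f (max i (N * i))))]
    refine add_mem ?_ ?_
    · rw [← map_sub]
      exact Ideal.mem_map_of_mem _ (hf (le_max_left _ _))
    · rw [Ideal.map_pow]
      refine Ideal.pow_right_mono hN i ?_
      rw [← pow_mul]
      exact Ideal.pow_le_pow_right (le_max_right _ _) (hL _)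

/-- If the form `(a, b) ↦ E (a * b)` is perfect away from the closed point, then `S` is
reflexive. -/
theorem isReflexive_of_retraction [IsDomain R] [IsDomain S] [IsLocalRing S] [Module.Finite R S]
    {x y : S} (hm : IsLocalRing.maximalIdeal S = Ideal.span {x, y}) (hx : Prime x) (hxy : ¬ x ∣ y)
    (E : S →ₗ[R] R) (hE : E 1 = 1)
    (H : ∀ q : Ideal S, q.IsPrime → q ≠ IsLocalRing.maximalIdeal S → ∀ φ : S →ₗ[R] R,
      ∃ s : R, algebraMap R S s ∉ q ∧ ∃ a : S, ∀ b, s * φ b = E (a * b)) :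
    Module.IsReflexive R S := by
  have hnz : ∀ a : S, a ≠ 0 → ∃ r : R, r ≠ 0 ∧ ∃ t, algebraMap R S r = a * t := by
    intro a ha
    obtain ⟨r, hr, hr0⟩ := Submodule.exists_mem_ne_zero_of_ne_bot
      (Ideal.comap_ne_bot_of_integral_mem (R := R) ha (Ideal.mem_span_singleton_self a)
        (Algebra.IsIntegral.isIntegral a))
    exact ⟨r, hr0, Ideal.mem_span_singleton.1 hr⟩
  let τ : S →ₗ[R] Module.Dual R S := (LinearMap.mul R S).compr₂ E
  have hτ : ∀ a b, τ a b = E (a * b) := fun a b => rfl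
  have hinj : Function.Injective τ := by
    rw [injective_iff_map_eq_zero]
    intro a ha
    by_contra h
    obtain ⟨r, hr0, t, ht⟩ := hnz a h
    refine hr0 ?_
    rw [← retraction_algebraMap E hE r, ht, ← hτ, ha, LinearMap.zero_apply]
  have hsurj : Function.Surjective τ := by
    intro φ
    -- `J` consists of the `s` for which `φ (s * ·)` is represented by the form. By `H` it lies in
    -- no nonmaximal prime, so it contains powers of `x` and `y`.
    let J : Ideal S :=
      { carrier := {s | ∃ a, ∀ b, φ (s * b) = E (a * b)}
        zero_mem' := ⟨0, fun b => by simp⟩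
        add_mem' := by
          rintro s t ⟨a, ha⟩ ⟨a', ha'⟩
          exact ⟨a + a', fun b => by rw [add_mul, add_mul, map_add, map_add, ha, ha']⟩
        smul_mem' := by
          rintro c s ⟨a, ha⟩
          exact ⟨a * c, fun b => by rw [smul_eq_mul, mul_comm c, mul_assoc, mul_assoc, ha]⟩ }
    have hJ : ∀ z ∈ IsLocalRing.maximalIdeal S, ∃ n : ℕ, z ^ n ∈ J := by
      intro z hz
      change z ∈ J.radical
      rw [Ideal.radical_eq_sInf]
      refine Submodule.mem_sInf.2 fun q ⟨hq, hqp⟩ => ?_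
      by_contra hzq
      obtain ⟨s, hs, a, ha⟩ := H q hqp (fun h => hzq (h ▸ hz)) φ
      refine hs (hq ⟨a, fun b => ?_⟩)
      rw [← Algebra.smul_def, map_smul, smul_eq_mul, ha]
    obtain ⟨n, a, ha⟩ := hJ x (hm ▸ Ideal.subset_span (by simp))
    obtain ⟨m, b, hb⟩ := hJ y (hm ▸ Ideal.subset_span (by simp))
    have hab : y ^ m * a = x ^ n * b := by
      apply hinj
      ext t
      rw [hτ, hτ, mul_right_comm, mul_comm, ← ha, mul_right_comm, mul_comm _ b, ← hb]
      congr 1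
      ring
    -- If `a` and `b` represent `φ (xⁿ ·)` and `φ (yᵐ ·)`, then `yᵐ a = xⁿ b`; coprimality gives `a
    -- = xⁿ c`, and `c` represents `φ`.
    obtain ⟨c, rfl⟩ := hx.pow_dvd_of_dvd_mul_left n (fun h => hxy (hx.dvd_of_dvd_pow h))
      ⟨b, hab⟩
    obtain ⟨r, hr0, t, ht⟩ := hnz (x ^ n) (pow_ne_zero _ hx.ne_zero)
    refine ⟨c, LinearMap.ext fun s => mul_left_cancel₀ hr0 ?_⟩
    rw [hτ, ← smul_eq_mul, ← smul_eq_mul r (φ s), ← map_smul, ← map_smul, Algebra.smul_def,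
      Algebra.smul_def, ht, mul_assoc (x ^ n) t s, ha]
    congr 1
    ring
  let e := LinearEquiv.ofBijective τ ⟨hinj, hsurj⟩
  constructor
  -- As the form is symmetric, biduality is the composite of the self-duality `e` and the inverse of
  -- its transpose.
  have : ⇑(Module.Dual.eval R S) = ⇑e.dualMap.symm ∘ ⇑e := by
    funext s
    rw [Function.comp_apply, LinearEquiv.eq_symm_apply]
    ext a
    change τ a s = τ s a
    rw [hτ, hτ, mul_comm]
  rw [this]
  exact e.dualMap.symm.bijective.comp e.bijective

end Retracts

/-! ### Freeness away from the closed point. -/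

section Freeness

/-- By Krull's height theorem the maximal ideal has height at most two, and a strictly smaller prime
has strictly smaller height. -/
theorem eq_maximalIdeal_of_two_le_height {S : Type*} [CommRing S] [IsLocalRing S]
    [IsNoetherianRing S] {x y : S} (hm : IsLocalRing.maximalIdeal S = Ideal.span {x, y})
    (q : Ideal S) [q.IsPrime] (hq : 2 ≤ q.height) : q = IsLocalRing.maximalIdeal S := by
  by_contra hne
  have hlt : q < IsLocalRing.maximalIdeal S :=
    lt_of_le_of_ne (IsLocalRing.le_maximalIdeal (Ideal.IsPrime.ne_top inferInstance)) hne
  have h2 : (IsLocalRing.maximalIdeal S).height ≤ 2 := by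
    classical
    refine (Ideal.height_le_card_of_mem_minimalPrimes_span_finset (s := {x, y}) ?_).trans ?_
    · rw [Finset.coe_pair, ← hm, Ideal.minimalPrimes_eq_subsingleton_self]
      rfl
    · exact_mod_cast Finset.card_le_two
  exact absurd (Ideal.height_strict_mono_of_isPrime hlt) (not_lt.2 (h2.trans hq))

variable {k : Type u} [Field k] {A : Type v} [CommRing A] [HopfAlgebra k A]
variable {S : Type w} [CommRing S] [Algebra k S]

theorem IsFreeInCodimOne.exists_smul_eq_reynolds_mul [IsLocalRing S] [IsNoetherianRing S]
    {ρ : S →ₐ[k] S ⊗[k] A} [Algebra.IsIntegral (invariants ρ) S] (hfree : IsFreeInCodimOne ρ)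
    (hρ : IsAction ρ) {x y : S} (hm : IsLocalRing.maximalIdeal S = Ideal.span {x, y})
    {l : A →ₗ[k] k}
    (hl : ∀ a, TensorProduct.rid k A (l.lTensor A (Coalgebra.comul a)) = l a • 1) {c : A}
    (hlc : l c = 1) (hc : ∀ a, a * c = Coalgebra.counit (R := k) a • c)
    (q : Ideal S) (hqp : q.IsPrime) (hq : q ≠ IsLocalRing.maximalIdeal S)
    (φ : S →ₗ[invariants ρ] invariants ρ) :
    ∃ s : invariants ρ, algebraMap (invariants ρ) S s ∉ q ∧
      ∃ a : S, ∀ b, s * φ b = reynolds hρ hl (a * b) := by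
  obtain ⟨Z, -, hZ, -, hb⟩ := hfree
  refine LRQ.exists_smul_eq_reynolds_mul hρ hl hlc hc (q.comap (algebraMap (invariants ρ) S))
    (hb (PrimeSpectrum.comap (algebraMap (invariants ρ) S) ⟨q, hqp⟩) ?_).2 φ
  -- A point of `Z` can only be the closed point; by integrality, a prime with the same contraction
  -- to `R` is maximal as well.
  rintro ⟨q', hq', heq⟩
  have h1 := eq_maximalIdeal_of_two_le_height hm q'.asIdeal (hZ q' hq')
  have h2 : q'.asIdeal.comap (algebraMap (invariants ρ) S) =
      q.comap (algebraMap (invariants ρ) S) := congrArg PrimeSpectrum.asIdeal heq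
  refine hq (IsLocalRing.eq_maximalIdeal
    (Ideal.isMaximal_of_isIntegral_of_isMaximal_comap (R := invariants ρ) q ?_))
  rw [← h2, h1]
  exact Ideal.isMaximal_comap_of_isIntegral_of_isMaximal _

end Freeness

end LRQ

/-! ### Assembly of the theorem. -/

theorem proposition3p4
    {k : Type u} [Field k] [IsAlgClosed k] (p : ℕ) [Fact p.Prime] [CharP k p]
    {A : Type v} [CommRing A] [HopfAlgebra k A] [Module.Finite k A]
    (hG : LRQ.IsLinearlyReductive k A)
    (ρ : MvPowerSeries (Fin 2) k →ₐ[k] MvPowerSeries (Fin 2) k ⊗[k] A)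
    (hρ : LRQ.IsAction ρ) (hfree : LRQ.IsFreeInCodimOne ρ) :
    -- the indecomposable reflexive modules are the indecomposable summands of the power series ring
    (∀ (M : Type u) [AddCommGroup M] [Module (LRQ.invariants ρ) M],
      (Module.Finite (LRQ.invariants ρ) M ∧ Module.IsReflexive (LRQ.invariants ρ) M ∧
          LRQ.IsIndecomposable (LRQ.invariants ρ) M) ↔
        (LRQ.IsSummand (LRQ.invariants ρ) M (MvPowerSeries (Fin 2) k) ∧
          LRQ.IsIndecomposable (LRQ.invariants ρ) M)) ∧
    -- the two full subcategories agree, and the inclusion is an equivalence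
    LRQ.addCat (LRQ.invariants ρ) (MvPowerSeries (Fin 2) k) =
      LRQ.reflexiveCat (LRQ.invariants ρ) ∧
    (∃ h : LRQ.addCat (LRQ.invariants ρ) (MvPowerSeries (Fin 2) k) ≤
        LRQ.reflexiveCat (LRQ.invariants ρ),
      (ObjectProperty.ιOfLE h).IsEquivalence) ∧
    -- finitely many isomorphism classes of indecomposable reflexive modules
    (∃ L : Set (ModuleCat.{u} (LRQ.invariants ρ)), L.Finite ∧
      ∀ M : ModuleCat.{u} (LRQ.invariants ρ),
        LRQ.reflexiveCat (LRQ.invariants ρ) M → LRQ.IsIndecomposable (LRQ.invariants ρ) M →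
          ∃ N ∈ L, Nonempty (M ≅ N)) := by
  obtain ⟨l, hl1, hl⟩ := hG.exists_right_integral
  obtain ⟨c, hlc, hc⟩ := LRQ.exists_integral_element hl1 hl
  set S := MvPowerSeries (Fin 2) k
  set R := LRQ.invariants ρ
  have hm := LRQ.maximalIdeal_eq_span_X (k := k)
  have hx := LRQ.prime_X_zero (k := k)
  have hS : IsDomain S := NoZeroDivisors.to_isDomain _
  have hSc := LRQ.isPrecomplete_maximalIdeal_mvPowerSeries (k := k)
  have hnoeth : IsNoetherian R S := LRQ.isNoetherian_invariants hρ hl1 hl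
  let E : S →ₗ[R] R := LRQ.reynolds hρ hl
  have hE : E 1 = 1 := LRQ.reynolds_one hρ hl1 hl
  have hRn : IsNoetherianRing R := LRQ.isNoetherianRing_of_retraction E hE
  have hfin : Module.Finite R S := inferInstance
  have hloc := LRQ.isLocalHom_of_retraction E hE
  have hRl : IsLocalRing R := RingHom.domain_isLocalRing (algebraMap R S)
  have hRc := LRQ.isPrecomplete_of_retraction E hE
  have hrefl : Module.IsReflexive R S :=
    LRQ.isReflexive_of_retraction hm hx LRQ.not_X_zero_dvd_X_one E hE
      (hfree.exists_smul_eq_reynolds_mul hρ hm hl hlc hc)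
  have hpi := LRQ.isReflexive_pi (R := R) (M := S)
  have hadd : LRQ.addCat R S = LRQ.reflexiveCat R := by
    funext M
    refine propext ⟨fun ⟨n, h⟩ => ⟨h.finite, h.isReflexive⟩, fun ⟨h1, h2⟩ => ?_⟩
    exact LRQ.isSummand_pi_of_isReflexive hm hx E hE M
  have hsummand : ∀ (M : Type u) [AddCommGroup M] [Module R M], Module.Finite R M →
      Module.IsReflexive R M → LRQ.IsIndecomposable R M → LRQ.IsSummand R M S := by
    intro M _ _ h1 h2 h3
    have := LRQ.isLocalRing_end h3
    obtain ⟨n, hn⟩ := LRQ.isSummand_pi_of_isReflexive hm hx E hE M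
    exact LRQ.isSummand_of_isSummand_pi hn
  refine ⟨fun M _ _ => ⟨fun ⟨h1, h2, h3⟩ => ⟨hsummand M h1 h2 h3, h3⟩,
    fun ⟨h1, h2⟩ => ⟨h1.finite, h1.isReflexive, h2⟩⟩, hadd, ⟨hadd.le, ?_⟩, ?_⟩
  · have : (ObjectProperty.ιOfLE hadd.le).EssSurj :=
      ⟨fun M => ⟨⟨M.obj, hadd.ge _ M.property⟩, ⟨Iso.refl _⟩⟩⟩
    exact {}
  · obtain ⟨L, hL, h⟩ := LRQ.exists_finite_summands (R := R) S
    exact ⟨L, hL, fun M ⟨h1, h2⟩ h3 =>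
      h M (LRQ.isLocalRing_end h3) (hsummand M h1 h2 h3)⟩
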